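/- Let $\Bbbk$ be a field, $n\ge 0$, $R=\Bbbk[x_1,\dots,x_n]$, and let $L\subseteq\mathbb Z^n$ be a lattice (a subgroup). Let $I_L=\langle x^u-x^v : u,v\in\mathbb N^n,\ u-v\in L\rangle\subseteq R$ be its lattice ideal, and let $L_{pure}$ be the subgroup of $L$ generated by $L\cap\mathbb N^n$. A binomial is a polynomial with exactly two monomial terms (with arbitrary nonzero coefficients). A Markov basis of $I_L$ is a minimal (with respect to inclusion) generating set of $I_L$ consisting of binomials whose cardinality is the least one among all such minimal generating sets. A binomial is indispensable if some nonzero constant multiple of it belongs to every Markov basis of $I_L$ (the constant may depend on the Markov basis); a monomial $x^u$ is indispensable if for every Markov basis $S$ of $I_L$ there is a $B\in S$ of which $x^u$ is a monomial term. If $\operatorname{rank}(L_{pure})>1$, then $I_L$ has no indispensable binomials, and its only indispensable monomial is $1=x^{\mathbf 0}$. If $\operatorname{rank}(L_{pure})=1$, then $I_L$ has, up to multiplication by a nonzero constant, exactly one indispensable binomial, and it has exactly two indispensable monomials. -/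

import Mathlib

namespace LatticeIdeal

open MvPolynomial

/-- The vector `u - v ∈ ℤⁿ` for exponent vectors `u, v ∈ ℕⁿ`. -/
def expDiff {n : ℕ} (u v : Fin n →₀ ℕ) : Fin n → ℤ :=
  fun i => (u i : ℤ) - (v i : ℤ)

/-- The lattice ideal `I_L = ⟨x^u - x^v : u - v ∈ L⟩` of `k[x₁, …, xₙ]`;
a lattice in `ℤⁿ` is a subgroup of `ℤⁿ`. -/
noncomputable def latticeIdeal (k : Type*) [Field k] {n : ℕ} (L : AddSubgroup (Fin n → ℤ)) :
    Ideal (MvPolynomial (Fin n) k) :=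
  Ideal.span {f | ∃ u v : Fin n →₀ ℕ, expDiff u v ∈ L ∧ f = monomial u 1 - monomial v 1}

/-- `L_pure`, the subgroup of `L` generated by `L⁺ = L ∩ ℕⁿ`. -/
def pureSublattice {n : ℕ} (L : AddSubgroup (Fin n → ℤ)) : AddSubgroup (Fin n → ℤ) :=
  AddSubgroup.closure {w | w ∈ L ∧ ∀ i, 0 ≤ w i}

/-- The rank of a lattice: its rank as a (finitely generated free) `ℤ`-module. -/
noncomputable def latticeRank {n : ℕ} (L : AddSubgroup (Fin n → ℤ)) : ℕ :=
  Module.finrank ℤ L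

/-- A binomial: a polynomial with exactly two monomial terms, with arbitrary nonzero
coefficients. -/
def IsBinomial {k : Type*} [Field k] {n : ℕ} (B : MvPolynomial (Fin n) k) : Prop :=
  ∃ (u v : Fin n →₀ ℕ) (a b : k), u ≠ v ∧ a ≠ 0 ∧ b ≠ 0 ∧ B = monomial u a + monomial v b

/-- `S` is a minimal system of binomial generators of the ideal `I`: it consists of binomials,
it generates `I`, and no proper subset of it generates `I`. -/
def IsMinimalBinomialGeneratingSet {k : Type*} [Field k] {n : ℕ}
    (I : Ideal (MvPolynomial (Fin n) k)) (S : Set (MvPolynomial (Fin n) k)) : Prop :=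
  (∀ B ∈ S, IsBinomial B) ∧ Ideal.span S = I ∧ ∀ T ⊂ S, Ideal.span T ≠ I

/-- A Markov basis of `I`: a minimal system of binomial generators whose cardinality is the least
one among all minimal systems of binomial generators of `I`. -/
def IsMarkovBasis {k : Type*} [Field k] {n : ℕ}
    (I : Ideal (MvPolynomial (Fin n) k)) (S : Set (MvPolynomial (Fin n) k)) : Prop :=
  IsMinimalBinomialGeneratingSet I S ∧
    ∀ T, IsMinimalBinomialGeneratingSet I T → S.encard ≤ T.encard

/-- An indispensable binomial of `I`: a binomial that appears, up to a (nonzero) constant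
multiple, in every Markov basis of `I`. -/
def IsIndispensableBinomial {k : Type*} [Field k] {n : ℕ}
    (I : Ideal (MvPolynomial (Fin n) k)) (B : MvPolynomial (Fin n) k) : Prop :=
  IsBinomial B ∧ ∀ S, IsMarkovBasis I S → ∃ c : k, c ≠ 0 ∧ c • B ∈ S

/-- The monomial `x^u` is indispensable for `I`: every Markov basis of `I` has an element
in which `x^u` occurs as a monomial term. -/
def IsIndispensableMonomial {k : Type*} [Field k] {n : ℕ}
    (I : Ideal (MvPolynomial (Fin n) k)) (u : Fin n →₀ ℕ) : Prop :=
  ∀ S, IsMarkovBasis I S → ∃ B ∈ S, u ∈ B.support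

end LatticeIdeal

namespace LatticeIdeal

open MvPolynomial

/-! ### Nonnegative generators of `L_pure` -/

section Generators

variable {n : ℕ}

/-! The variables in `pureSupport L` are exactly the units modulo `I_L`. Call a binomial pure if it
involves only these variables. The exponent differences of the pure elements of any binomial
generating set generate `L_pure` (`exists_expDiff_closure`), so there are at least `rank L_pure`
pure elements.

Conversely, in a Markov basis the pure elements may be exchanged for `x^c - 1`, with `c` running
over any `rank L_pure` nonnegative generators of `L_pure`, and the other elements may be multiplied
by `x^d` with `d ∈ L ∩ ℕⁿ` (`IsMarkovBasis.replace_purePart`). Taking `d` large removes every given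
monomial from the impure elements, so an indispensable monomial is `1` or one of the `x^c`.

If the rank exceeds one, the `c` can be chosen arbitrarily large (`exists_large_generators`) and
only `1` survives. If the rank is one, the generator `w` is unique, and every Markov basis contains
a multiple of `x^w - 1` (`isIndispensableBinomial_of_closure`). -/

theorem exists_generators_extending (P : AddSubgroup (Fin n → ℤ)) {p : Fin n → ℤ} (hp : p ∈ P)
    (hp0 : p ≠ 0) : ∃ (b : Fin (latticeRank P) → Fin n → ℤ) (j : Fin (latticeRank P)) (z : ℤ),
      0 < z ∧ p = z • b j ∧ AddSubgroup.closure (Set.range b) = P := by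
  suffices h : ∃ (b : Fin (latticeRank P) → Fin n → ℤ) (j : Fin (latticeRank P)) (z : ℤ),
      p = z • b j ∧ AddSubgroup.closure (Set.range b) = P by
    obtain ⟨b, j, z, rfl, hb⟩ := h
    rcases lt_trichotomy z 0 with hz | rfl | hz
    · refine ⟨-b, j, -z, by omega, by simp, ?_⟩
      refine Eq.trans ?_ hb
      rw [← AddSubgroup.closure_neg (Set.range b)]
      congr 1
      ext x
      simp [neg_eq_iff_eq_neg]
    · simp at hp0
    · exact ⟨b, j, z, hz, rfl, hb⟩
  let Q : Submodule ℤ (Fin n → ℤ) := AddSubgroup.toIntSubmodule P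
  let b₀ : Module.Basis (Fin (latticeRank P)) ℤ Q := Module.finBasis ℤ Q
  let x : Q := ⟨p, hp⟩
  have hx0 : x ≠ 0 := fun h => hp0 (congrArg Subtype.val h)
  -- Smith normal form of the line `ℤx` inside `P` yields a basis of `P` one of whose vectors has
  -- `x` as a multiple.
  obtain ⟨m, bM, bN, f, a, snf⟩ := Submodule.smithNormalForm b₀ (Submodule.span ℤ {x})
  have hxN : x ∈ Submodule.span ℤ {x} := Submodule.mem_span_singleton_self x
  have hm : m ≤ 1 := by
    have h1 := Module.finrank_eq_card_basis bN
    have h2 := finrank_span_le_card (R := ℤ) ({x} : Set Q)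
    simp at h1 h2
    omega
  have hsum := bN.sum_repr ⟨x, hxN⟩
  have hm1 : m = 1 := by
    rcases Nat.lt_or_ge m 1 with h | h
    · obtain rfl : m = 0 := by omega
      simp at hsum
      exact absurd (congrArg Subtype.val hsum).symm hx0
    · omega
  subst hm1
  refine ⟨fun j => (bM j : Fin n → ℤ), f 0, bN.repr ⟨x, hxN⟩ 0 * a 0, ?_, ?_⟩
  · have h := congrArg (fun t : Submodule.span ℤ {x} => ((t : Q) : Fin n → ℤ)) hsum
    simp only [Fin.sum_univ_one, Submodule.coe_smul, snf] at h
    rw [mul_smul]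
    exact h.symm
  · apply AddSubgroup.toIntSubmodule.injective
    rw [AddSubgroup.toIntSubmodule_closure]
    have h : Set.range (fun j => (bM j : Fin n → ℤ)) = Q.subtype '' Set.range bM := by
      rw [← Set.range_comp]; rfl
    rw [h, Submodule.span_image, bM.span_eq, Submodule.map_top, Submodule.range_subtype]

/-- The coordinates that are positive at some nonnegative vector of `L`. -/
def pureSupport (L : AddSubgroup (Fin n → ℤ)) : Set (Fin n) :=
  {i | ∃ w ∈ L, (∀ j, 0 ≤ w j) ∧ 0 < w i}

theorem pureSublattice_le (L : AddSubgroup (Fin n → ℤ)) : pureSublattice L ≤ L :=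
  (AddSubgroup.closure_le _).2 fun _ h => h.1

theorem eq_zero_of_mem_pureSublattice {L : AddSubgroup (Fin n → ℤ)} {h : Fin n → ℤ}
    (hh : h ∈ pureSublattice L) {i : Fin n} (hi : i ∉ pureSupport L) : h i = 0 := by
  induction hh using AddSubgroup.closure_induction with
  | mem w hw =>
    by_contra h0
    exact hi ⟨w, hw.1, hw.2, lt_of_le_of_ne (hw.2 i) (Ne.symm h0)⟩
  | zero => rfl
  | add a b _ _ ha hb => simp [ha, hb]
  | neg a _ ha => simp [ha]

theorem exists_pos_on_pureSupport (L : AddSubgroup (Fin n → ℤ)) :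
    ∃ w ∈ L, (∀ j, 0 ≤ w j) ∧ ∀ i ∈ pureSupport L, 0 < w i := by
  classical
  have h : ∀ i, ∃ w ∈ L, (∀ j, 0 ≤ w j) ∧ (i ∈ pureSupport L → 0 < w i) := by
    intro i
    by_cases hi : i ∈ pureSupport L
    · obtain ⟨w, h1, h2, h3⟩ := hi
      exact ⟨w, h1, h2, fun _ => h3⟩
    · exact ⟨0, L.zero_mem, fun _ => le_rfl, fun h => absurd h hi⟩
  choose w h1 h2 h3 using h
  refine ⟨∑ i, w i, L.sum_mem fun i _ => h1 i, fun j => ?_, fun i hi => ?_⟩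
  · rw [Finset.sum_apply]
    exact Finset.sum_nonneg fun i _ => h2 i j
  · rw [Finset.sum_apply]
    exact Finset.sum_pos' (fun a _ => h2 a i) ⟨i, Finset.mem_univ _, h3 i hi⟩

/-- A nonnegative multiple of a vector positive on the pure support dominates any given vector
there. -/
theorem exists_large_on_pureSupport (L : AddSubgroup (Fin n → ℤ)) (m : ℤ) :
    ∃ w ∈ L, (∀ j, 0 ≤ w j) ∧ ∀ i ∈ pureSupport L, m < w i := by
  obtain ⟨w, h1, h2, h3⟩ := exists_pos_on_pureSupport L
  refine ⟨(|m| + 1) • w, L.zsmul_mem h1 _, fun j => ?_, fun i hi => ?_⟩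
  · have := h2 j
    simp only [Pi.smul_apply, smul_eq_mul]
    positivity
  · have := h3 i hi
    simp only [Pi.smul_apply, smul_eq_mul]
    nlinarith [abs_nonneg m, le_abs_self m]

/-- Write `h = (h + w) - w` with `w ∈ L ∩ ℕⁿ` so large on the pure support that `h + w` is
nonnegative too. -/
theorem mem_pureSublattice_of_support {L : AddSubgroup (Fin n → ℤ)} {h : Fin n → ℤ} (hh : h ∈ L)
    (hs : ∀ i ∉ pureSupport L, h i = 0) : h ∈ pureSublattice L := by
  obtain ⟨w, h1, h2, h3⟩ := exists_large_on_pureSupport L (∑ i, |h i|)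
  have hw : w ∈ pureSublattice L := AddSubgroup.subset_closure ⟨h1, h2⟩
  rw [← add_sub_cancel_right h w]
  refine AddSubgroup.sub_mem _ (AddSubgroup.subset_closure ⟨L.add_mem hh h1, fun i => ?_⟩) hw
  by_cases hi : i ∈ pureSupport L
  · have := h3 i hi
    have h4 : |h i| ≤ ∑ i, |h i| :=
      Finset.single_le_sum (f := fun i => |h i|) (fun _ _ => abs_nonneg _) (Finset.mem_univ i)
    have := neg_abs_le (h i)
    simp only [Pi.add_apply]
    omega
  · simp [hs i hi, h2 i]

theorem pureSupport_nonempty {L : AddSubgroup (Fin n → ℤ)}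
    (hr : latticeRank (pureSublattice L) ≠ 0) : (pureSupport L).Nonempty := by
  by_contra he
  rw [Set.not_nonempty_iff_eq_empty] at he
  apply hr
  have : Subsingleton (pureSublattice L) := by
    refine ⟨fun a b => Subtype.ext (funext fun i => ?_)⟩
    rw [eq_zero_of_mem_pureSublattice a.2 (by simp [he]),
      eq_zero_of_mem_pureSublattice b.2 (by simp [he])]
  exact Module.finrank_zero_of_subsingleton

theorem exists_exponent {w : Fin n → ℤ} (hw : ∀ i, 0 ≤ w i) :
    ∃ c : Fin n →₀ ℕ, expDiff c 0 = w :=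
  ⟨Finsupp.equivFunOnFinite.symm fun i => (w i).toNat, funext fun i => by simp [expDiff, hw i]⟩

/-- A basis adapted to a vector positive on the pure support has a member `b j₀` positive there;
adding a large multiple of it enlarges the other members. -/
theorem exists_large_generators {L : AddSubgroup (Fin n → ℤ)}
    (hr : 1 < latticeRank (pureSublattice L)) (m : ℕ) :
    ∃ c : Fin (latticeRank (pureSublattice L)) → Fin n →₀ ℕ,
      (∀ j, ∀ i ∈ pureSupport L, m < c j i) ∧
      AddSubgroup.closure (Set.range fun j => expDiff (c j) 0) = pureSublattice L := by
  obtain ⟨w, h1, h2, h3⟩ := exists_pos_on_pureSupport L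
  obtain ⟨i₀, hi₀⟩ := pureSupport_nonempty (L := L) (by omega)
  have hw0 : w ≠ 0 := fun h => by simpa [h] using h3 i₀ hi₀
  have hwp : w ∈ pureSublattice L := AddSubgroup.subset_closure ⟨h1, h2⟩
  obtain ⟨b, j₀, z, hz, hwz, hb⟩ := exists_generators_extending _ hwp hw0
  have hbP : ∀ j, b j ∈ pureSublattice L := fun j => hb ▸ AddSubgroup.subset_closure ⟨j, rfl⟩
  have hq : ∀ i ∈ pureSupport L, 0 < b j₀ i := by
    intro i hi
    have := h3 i hi
    rw [hwz, Pi.smul_apply, smul_eq_mul] at this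
    exact pos_of_mul_pos_right this hz.le
  obtain ⟨M, hM, hM0⟩ : ∃ M : ℤ, (∀ j i, (m : ℤ) - b j i < M) ∧ 0 ≤ M := by
    refine ⟨m + ∑ j, ∑ i, |b j i| + 1, fun j i => ?_, by positivity⟩
    have h4 : |b j i| ≤ ∑ i, |b j i| :=
      Finset.single_le_sum (f := fun i => |b j i|) (fun _ _ => abs_nonneg _) (Finset.mem_univ i)
    have h5 : ∑ i, |b j i| ≤ ∑ j, ∑ i, |b j i| :=
      Finset.single_le_sum (f := fun j => ∑ i, |b j i|)
        (fun _ _ => Finset.sum_nonneg fun _ _ => abs_nonneg _) (Finset.mem_univ j)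
    have := neg_abs_le (b j i)
    omega
  have : Nontrivial (Fin (latticeRank (pureSublattice L))) := Fin.nontrivial_iff_two_le.2 hr
  obtain ⟨j₁, hj₁⟩ := exists_ne j₀
  -- Scaling `b j₀` itself would lose generators. A second index `j₁`, available since the rank
  -- exceeds one, lets `b j₀` be recovered as `b' j₀ - b' j₁`.
  let b' : Fin (latticeRank (pureSublattice L)) → Fin n → ℤ :=
    fun j => if j = j₀ then b j₀ + (b j₁ + M • b j₀) else b j + M • b j₀
  have hlarge : ∀ j, ∀ i ∈ pureSupport L, m < (b j + M • b j₀) i := by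
    intro j i hi
    have h4 := hM j i
    have h5 := hq i hi
    simp only [Pi.add_apply, Pi.smul_apply, smul_eq_mul]
    nlinarith
  have hb'P : ∀ j, b' j ∈ pureSublattice L := by
    intro j
    have h6 : ∀ j, b j + M • b j₀ ∈ pureSublattice L := fun j =>
      AddSubgroup.add_mem _ (hbP j) (AddSubgroup.zsmul_mem _ (hbP _) _)
    by_cases hj : j = j₀
    · simp only [b', hj, if_true]
      exact AddSubgroup.add_mem _ (hbP _) (h6 _)
    · simp only [b', hj, if_false]
      exact h6 _
  have hb'large : ∀ j, ∀ i ∈ pureSupport L, m < b' j i := by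
    intro j i hi
    by_cases hj : j = j₀
    · have h4 := hlarge j₁ i hi
      have h5 := hq i hi
      simp only [b', hj, if_true, Pi.add_apply] at h4 ⊢
      omega
    · simpa only [b', hj, if_false] using hlarge j i hi
  have hb'0 : ∀ j i, 0 ≤ b' j i := by
    intro j i
    by_cases hi : i ∈ pureSupport L
    · have := hb'large j i hi
      omega
    · exact (eq_zero_of_mem_pureSublattice (hb'P j) hi).ge
  choose c hc using fun j => exists_exponent (hb'0 j)
  refine ⟨c, fun j i hi => ?_, ?_⟩
  · have := hb'large j i hi
    rw [← hc j] at this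
    simpa [expDiff] using this
  · simp only [hc]
    apply le_antisymm
    · rw [AddSubgroup.closure_le]
      rintro _ ⟨j, rfl⟩
      exact hb'P j
    · have hmem : ∀ j, b' j ∈ AddSubgroup.closure (Set.range b') :=
        fun j => AddSubgroup.subset_closure ⟨j, rfl⟩
      have hqmem : b j₀ ∈ AddSubgroup.closure (Set.range b') := by
        have h4 : b j₀ = b' j₀ - b' j₁ := by simp [b', hj₁]
        rw [h4]
        exact AddSubgroup.sub_mem _ (hmem _) (hmem _)
      refine hb.ge.trans ?_
      rw [AddSubgroup.closure_le]
      rintro _ ⟨j, rfl⟩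
      by_cases hj : j = j₀
      · exact hj ▸ hqmem
      · have h4 : b j = b' j - M • b j₀ := by simp [b', hj]
        rw [h4]
        exact AddSubgroup.sub_mem _ (hmem _) (AddSubgroup.zsmul_mem _ hqmem _)

theorem exists_generator_of_rank_one {L : AddSubgroup (Fin n → ℤ)}
    (hr : latticeRank (pureSublattice L) = 1) :
    ∃ w : Fin n →₀ ℕ, w ≠ 0 ∧ AddSubgroup.closure {expDiff w 0} = pureSublattice L := by
  obtain ⟨w, h1, h2, h3⟩ := exists_pos_on_pureSupport L
  obtain ⟨i₀, hi₀⟩ := pureSupport_nonempty (L := L) (by omega)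
  have hw0 : w ≠ 0 := fun h => by simpa [h] using h3 i₀ hi₀
  have hwp : w ∈ pureSublattice L := AddSubgroup.subset_closure ⟨h1, h2⟩
  obtain ⟨b, j₀, z, hz, hwz, hb⟩ := exists_generators_extending _ hwp hw0
  have : Subsingleton (Fin (latticeRank (pureSublattice L))) := by rw [hr]; infer_instance
  obtain ⟨c, hc⟩ : ∃ c : Fin n →₀ ℕ, expDiff c 0 = b j₀ := by
    refine exists_exponent fun i => ?_
    have := h2 i
    rw [hwz, Pi.smul_apply, smul_eq_mul] at this
    exact nonneg_of_mul_nonneg_right this hz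
  refine ⟨c, ?_, ?_⟩
  · rintro rfl
    apply hw0
    rw [hwz, ← hc]
    ext i
    simp [expDiff]
  · rw [hc]
    refine Eq.trans ?_ hb
    congr 1
    ext x
    constructor
    · rintro rfl
      exact ⟨j₀, rfl⟩
    · rintro ⟨j, rfl⟩
      rw [Subsingleton.elim j j₀]
      rfl

end Generators

/-! ### Markov bases as smallest binomial generating sets -/

section MarkovBases

variable {k : Type*} [Field k] {n : ℕ} {I : Ideal (MvPolynomial (Fin n) k)}

theorem isMarkovBasis_of_finite {S : Set (MvPolynomial (Fin n) k)} (hfin : S.Finite)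
    (hS : ∀ B ∈ S, IsBinomial B) (hspan : Ideal.span S = I)
    (hmin : ∀ T : Set (MvPolynomial (Fin n) k), (∀ B ∈ T, IsBinomial B) → Ideal.span T = I →
      S.encard ≤ T.encard) : IsMarkovBasis I S :=
  ⟨⟨hS, hspan, fun T hT h => absurd (hmin T (fun B hB => hS B (hT.subset hB)) h)
    (not_le.2 ((hfin.subset hT.subset).encard_lt_encard hT))⟩, fun T hT => hmin T hT.1 hT.2.1⟩

/-- By noetherianity some finite subset of `G` generates. A binomial generating set of least
cardinality is then finite, hence inclusion-minimal. The comparison is with all binomial generating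
sets, so that later no minimality has to be checked. -/
theorem exists_markovBasis_le {G : Set (MvPolynomial (Fin n) k)} (hG : ∀ B ∈ G, IsBinomial B)
    (hspan : Ideal.span G = I) : ∃ S, IsMarkovBasis I S ∧ S.Finite ∧
      ∀ T : Set (MvPolynomial (Fin n) k), (∀ B ∈ T, IsBinomial B) → Ideal.span T = I →
        S.encard ≤ T.encard := by
  obtain ⟨F, hFG, hF⟩ := (Submodule.fg_span_iff_fg_span_finset_subset G).1
    (IsNoetherian.noetherian (Ideal.span G))
  let C : Set (Set (MvPolynomial (Fin n) k)) := {T | (∀ B ∈ T, IsBinomial B) ∧ Ideal.span T = I}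
  have hFC : (F : Set (MvPolynomial (Fin n) k)) ∈ C :=
    ⟨fun B hB => hG B (hFG hB), hF.symm.trans hspan⟩
  obtain ⟨S, hSC, hSmin⟩ := exists_minimalFor_of_wellFoundedLT (· ∈ C) Set.encard ⟨_, hFC⟩
  have hmin : ∀ T ∈ C, S.encard ≤ T.encard := fun T hT =>
    (le_total S.encard T.encard).elim id fun h => hSmin hT h
  have hfin : S.Finite := Set.finite_of_encard_le_coe (k := F.card) (by
    simpa using hmin _ hFC)
  exact ⟨S, isMarkovBasis_of_finite hfin hSC.1 hSC.2 fun T h1 h2 => hmin T ⟨h1, h2⟩, hfin,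
    fun T h1 h2 => hmin T ⟨h1, h2⟩⟩

theorem IsMarkovBasis.encard_le {S T : Set (MvPolynomial (Fin n) k)} (hS : IsMarkovBasis I S)
    (hT : ∀ B ∈ T, IsBinomial B) (hspan : Ideal.span T = I) : S.encard ≤ T.encard := by
  obtain ⟨S₀, h1, -, h2⟩ := exists_markovBasis_le hT hspan
  exact (hS.2 S₀ h1.1).trans (h2 T hT hspan)

theorem IsMarkovBasis.finite {S : Set (MvPolynomial (Fin n) k)} (hS : IsMarkovBasis I S) :
    S.Finite := by
  obtain ⟨S₀, h1, h2, -⟩ := exists_markovBasis_le hS.1.1 hS.1.2.1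
  exact Set.encard_lt_top_iff.1 ((hS.2 S₀ h1.1).trans_lt (Set.encard_lt_top_iff.2 h2))

theorem IsMarkovBasis.of_encard_le {S T : Set (MvPolynomial (Fin n) k)} (hS : IsMarkovBasis I S)
    (hT : ∀ B ∈ T, IsBinomial B) (hspan : Ideal.span T = I) (hle : T.encard ≤ S.encard) :
    IsMarkovBasis I T :=
  isMarkovBasis_of_finite
    (Set.encard_lt_top_iff.1 (hle.trans_lt (Set.encard_lt_top_iff.2 hS.finite))) hT hspan
    fun _ h1 h2 => hle.trans (hS.encard_le h1 h2)

end MarkovBases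

/-! ### Homomorphisms to group algebras of quotients of `ℤⁿ` -/

section Grading

variable {k : Type*} [Field k] {n : ℕ}

@[simp]
theorem expDiff_self (u : Fin n →₀ ℕ) : expDiff u u = 0 := by
  ext i; simp [expDiff]

theorem expDiff_add (u v a b : Fin n →₀ ℕ) :
    expDiff (u + a) (v + b) = expDiff u v + expDiff a b := by
  ext i; simp [expDiff]; ring

theorem expDiff_swap (u v : Fin n →₀ ℕ) : expDiff u v = -expDiff v u := by
  ext i; simp [expDiff]

open Classical in
/-- The homomorphism to the group algebra of `ℤⁿ / K` that sends `x_i` to the class of the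
`i`-th unit vector for `i ∈ A` and to `0` for `i ∉ A`. -/
noncomputable def quotientHom (k : Type*) [Field k] {n : ℕ} (A : Set (Fin n))
    (K : AddSubgroup (Fin n → ℤ)) :
    MvPolynomial (Fin n) k →ₐ[k] AddMonoidAlgebra k ((Fin n → ℤ) ⧸ K) :=
  aeval fun i => if i ∈ A then
    AddMonoidAlgebra.of k _ (Multiplicative.ofAdd (QuotientAddGroup.mk (Pi.single i 1))) else 0

theorem sum_smul_single (u : Fin n →₀ ℕ) :
    ∑ i, u i • (Pi.single i 1 : Fin n → ℤ) = expDiff u 0 := by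
  ext j
  simp [expDiff, Finset.sum_apply, Pi.single_apply]

open Classical in
theorem quotientHom_monomial_of_subset {A : Set (Fin n)} {K : AddSubgroup (Fin n → ℤ)}
    {u : Fin n →₀ ℕ} (hu : ∀ i ∈ u.support, i ∈ A) (a : k) :
    quotientHom k A K (monomial u a) =
      AddMonoidAlgebra.single (QuotientAddGroup.mk (expDiff u 0)) a := by
  have h : (u.prod fun i m => (if i ∈ A then AddMonoidAlgebra.of k ((Fin n → ℤ) ⧸ K)
      (Multiplicative.ofAdd (QuotientAddGroup.mk (Pi.single i 1))) else 0) ^ m) =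
      AddMonoidAlgebra.of k _ (Multiplicative.ofAdd (QuotientAddGroup.mk (expDiff u 0))) := by
    rw [← sum_smul_single, Finsupp.prod]
    rw [Finset.prod_congr rfl fun i hi => by rw [if_pos (hu i hi)]]
    simp only [← map_pow, ← map_prod]
    congr 1
    rw [← Finset.sum_subset (Finset.subset_univ u.support) (fun i _ hi => by
      simp [Finsupp.notMem_support_iff.1 hi])]
    have h2 := map_sum (QuotientAddGroup.mk' K)
      (fun i => u i • (Pi.single i 1 : Fin n → ℤ)) u.support
    simp only [QuotientAddGroup.mk'_apply] at h2
    rw [h2, ofAdd_sum]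
    rfl
  rw [quotientHom, aeval_monomial]
  convert congrArg (algebraMap k _ a * ·) h using 1
  simp [AddMonoidAlgebra.single_mul_single]

theorem quotientHom_monomial_of_not_subset {A : Set (Fin n)} {K : AddSubgroup (Fin n → ℤ)}
    {u : Fin n →₀ ℕ} {i : Fin n} (hu : i ∈ u.support) (hi : i ∉ A) (a : k) :
    quotientHom k A K (monomial u a) = 0 := by
  rw [quotientHom, aeval_monomial, Finsupp.prod,
    Finset.prod_eq_zero hu (by simp [hi, Finsupp.mem_support_iff.1 hu]), mul_zero]

theorem mk_expDiff_eq_iff {K : AddSubgroup (Fin n → ℤ)} {u v : Fin n →₀ ℕ} :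
    (QuotientAddGroup.mk (expDiff u 0) : (Fin n → ℤ) ⧸ K) = QuotientAddGroup.mk (expDiff v 0) ↔
      expDiff u v ∈ K := by
  rw [eq_comm, QuotientAddGroup.eq]
  have : -expDiff v 0 + expDiff u 0 = expDiff u v := by
    ext i; simp [expDiff]; ring
  rw [this]

theorem monomial_sub_mem_latticeIdeal {L : AddSubgroup (Fin n → ℤ)} {u v : Fin n →₀ ℕ}
    (h : expDiff u v ∈ L) : monomial u (1 : k) - monomial v 1 ∈ latticeIdeal k L :=
  Ideal.subset_span ⟨u, v, h, rfl⟩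

theorem latticeIdeal_le_ker_quotientHom (L : AddSubgroup (Fin n → ℤ)) :
    latticeIdeal k L ≤ RingHom.ker (quotientHom k Set.univ L) := by
  rw [latticeIdeal, Ideal.span_le]
  rintro _ ⟨u, v, h, rfl⟩
  rw [SetLike.mem_coe, RingHom.mem_ker, map_sub, quotientHom_monomial_of_subset (by simp),
    quotientHom_monomial_of_subset (by simp), mk_expDiff_eq_iff.2 h, sub_self]

/-- In the group algebra of `ℤⁿ / L` the two terms become multiples of basis elements, which cancel
only if their classes agree. -/
theorem binomial_mem_latticeIdeal {L : AddSubgroup (Fin n → ℤ)} {u v : Fin n →₀ ℕ} {a b : k}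
    (ha : a ≠ 0) (h : monomial u a + monomial v b ∈ latticeIdeal k L) :
    b = -a ∧ expDiff u v ∈ L := by
  have h1 := latticeIdeal_le_ker_quotientHom L h
  rw [RingHom.mem_ker, map_add, quotientHom_monomial_of_subset (by simp),
    quotientHom_monomial_of_subset (by simp)] at h1
  by_cases huv : expDiff u v ∈ L
  · rw [mk_expDiff_eq_iff.2 huv, ← AddMonoidAlgebra.single_add,
      AddMonoidAlgebra.single_eq_zero] at h1
    exact ⟨(neg_eq_of_add_eq_zero_right h1).symm, huv⟩
  · have h2 := congrArg (fun f => f.coeff (QuotientAddGroup.mk (expDiff u 0))) h1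
    have hne := mt mk_expDiff_eq_iff.1 huv
    simp [Ne.symm hne, ha] at h2

end Grading

/-! ### The pure part of a generating set and its replacement -/

section PurePart

variable {k : Type*} [Field k] {n : ℕ} {L : AddSubgroup (Fin n → ℤ)}

theorem support_subset_pureSupport {u v : Fin n →₀ ℕ} (h : expDiff u v ∈ L)
    (hu : ∀ i ∈ u.support, i ∈ pureSupport L) : ∀ i ∈ v.support, i ∈ pureSupport L := by
  obtain ⟨w, h1, h2, h3⟩ := exists_large_on_pureSupport L (∑ i, (u i : ℤ))
  intro i hi
  by_contra hiA
  have hu0 : ∀ j, j ∉ pureSupport L → u j = 0 := fun j hj =>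
    Finsupp.notMem_support_iff.1 (mt (hu j) hj)
  -- `w - u + v` is nonnegative, as `w` exceeds `u` on the pure support and `u` vanishes off it; it
  -- is positive at `i`, where `v` is.
  refine hiA ⟨w - expDiff u v, L.sub_mem h1 h, fun j => ?_, ?_⟩
  · by_cases hj : j ∈ pureSupport L
    · have := h3 j hj
      have h4 : (u j : ℤ) ≤ ∑ j, (u j : ℤ) :=
        Finset.single_le_sum (f := fun j => (u j : ℤ)) (fun _ _ => by positivity)
          (Finset.mem_univ j)
      simp only [Pi.sub_apply, expDiff]
      omega
    · have := h2 j
      simp only [Pi.sub_apply, expDiff, hu0 j hj]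
      omega
  · have := h2 i
    have := Finsupp.mem_support_iff.1 hi
    simp only [Pi.sub_apply, expDiff, hu0 i hiA]
    omega

theorem isBinomial_smul_sub {u v : Fin n →₀ ℕ} (huv : u ≠ v) {a : k} (ha : a ≠ 0) :
    IsBinomial (a • (monomial u (1 : k) - monomial v 1)) :=
  ⟨u, v, a, -a, huv, ha, neg_ne_zero.2 ha, by
    simp [smul_monomial, sub_eq_add_neg]⟩

theorem isBinomial_sub {u v : Fin n →₀ ℕ} (huv : u ≠ v) :
    IsBinomial (monomial u (1 : k) - monomial v 1) := by
  simpa using isBinomial_smul_sub huv (one_ne_zero (α := k))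

theorem support_smul_sub {u v : Fin n →₀ ℕ} (huv : u ≠ v) {a : k} (ha : a ≠ 0) :
    (a • (monomial u (1 : k) - monomial v 1)).support = {u, v} := by
  ext t
  rw [mem_support_iff, coeff_smul, coeff_sub, coeff_monomial, coeff_monomial]
  by_cases h1 : u = t <;> by_cases h2 : v = t <;> simp_all [eq_comm]

theorem exists_eq_smul_of_mem {B : MvPolynomial (Fin n) k} (hB : IsBinomial B)
    (hmem : B ∈ latticeIdeal k L) : ∃ (u v : Fin n →₀ ℕ) (a : k), u ≠ v ∧ a ≠ 0 ∧
      expDiff u v ∈ L ∧ B = a • (monomial u 1 - monomial v 1) := by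
  obtain ⟨u, v, a, b, huv, ha, hb, rfl⟩ := hB
  obtain ⟨rfl, h⟩ := binomial_mem_latticeIdeal ha hmem
  exact ⟨u, v, a, huv, ha, h, by simp [smul_monomial, sub_eq_add_neg]⟩

variable (L) in
/-- The elements of `S` that involve only variables which are units modulo `I_L`. -/
def purePart (S : Set (MvPolynomial (Fin n) k)) : Set (MvPolynomial (Fin n) k) :=
  {B ∈ S | ∀ u ∈ B.support, ∀ i ∈ u.support, i ∈ pureSupport L}

theorem purePart_subset (S : Set (MvPolynomial (Fin n) k)) : purePart L S ⊆ S :=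
  fun _ h => h.1

/-- Let `K` be generated by the differences of the pure elements. Sending the variables outside the
pure support to `0` and the others to their classes modulo `K` kills all of `S`: in an impure
binomial both terms vanish. Hence it kills `x^c - 1` for `c ∈ L ∩ ℕⁿ`, which puts `c` in `K`. -/
theorem exists_expDiff_closure {S : Set (MvPolynomial (Fin n) k)}
    (hS : ∀ B ∈ S, IsBinomial B) (hspan : Ideal.span S = latticeIdeal k L) :
    ∃ g : MvPolynomial (Fin n) k → Fin n → ℤ,
      (∀ B ∈ S, ∃ (u v : Fin n →₀ ℕ) (a : k), u ≠ v ∧ a ≠ 0 ∧ expDiff u v ∈ L ∧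
        B = a • (monomial u 1 - monomial v 1) ∧ g B = expDiff u v) ∧
      pureSublattice L ≤ AddSubgroup.closure (g '' purePart L S) := by
  have hg : ∀ B : MvPolynomial (Fin n) k, ∃ g : Fin n → ℤ, B ∈ S →
      ∃ (u v : Fin n →₀ ℕ) (a : k), u ≠ v ∧ a ≠ 0 ∧ expDiff u v ∈ L ∧
        B = a • (monomial u 1 - monomial v 1) ∧ g = expDiff u v := by
    intro B
    by_cases hB : B ∈ S
    · obtain ⟨u, v, a, h1, h2, h3, h4⟩ :=
        exists_eq_smul_of_mem (hS B hB) (hspan ▸ Ideal.subset_span hB)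
      exact ⟨expDiff u v, fun _ => ⟨u, v, a, h1, h2, h3, h4, rfl⟩⟩
    · exact ⟨0, fun h => absurd h hB⟩
  choose g hg using hg
  refine ⟨g, hg, ?_⟩
  set K := AddSubgroup.closure (g '' purePart L S)
  have hker : latticeIdeal k L ≤ RingHom.ker (quotientHom k (pureSupport L) K) := by
    rw [← hspan, Ideal.span_le]
    intro B hB
    obtain ⟨u, v, a, huv, ha, hL, hBeq, hgB⟩ := hg B hB
    rw [SetLike.mem_coe, RingHom.mem_ker, hBeq, map_smul, map_sub]
    by_cases hu : ∀ i ∈ u.support, i ∈ pureSupport L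
    · have hv := support_subset_pureSupport hL hu
      have hpure : B ∈ purePart L S := by
        refine ⟨hB, fun t ht => ?_⟩
        rw [hBeq, support_smul_sub huv ha, Finset.mem_insert, Finset.mem_singleton] at ht
        rcases ht with rfl | rfl
        · exact hu
        · exact hv
      have hmem : expDiff u v ∈ K := hgB ▸ AddSubgroup.subset_closure ⟨B, hpure, rfl⟩
      rw [quotientHom_monomial_of_subset hu, quotientHom_monomial_of_subset hv,
        mk_expDiff_eq_iff.2 hmem, sub_self, smul_zero]
    · have hv : ¬ ∀ i ∈ v.support, i ∈ pureSupport L := fun hv =>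
        hu (support_subset_pureSupport (by rw [expDiff_swap]; exact L.neg_mem hL) hv)
      push Not at hu hv
      obtain ⟨i, hi, hi'⟩ := hu
      obtain ⟨j, hj, hj'⟩ := hv
      rw [quotientHom_monomial_of_not_subset hi hi', quotientHom_monomial_of_not_subset hj hj',
        sub_self, smul_zero]
  refine (AddSubgroup.closure_le _).2 fun w hw => ?_
  obtain ⟨c, rfl⟩ := exists_exponent hw.2
  have h1 := hker (monomial_sub_mem_latticeIdeal (k := k) hw.1)
  have hc : ∀ i ∈ c.support, i ∈ pureSupport L := fun i hi =>
    ⟨_, hw.1, hw.2, by simpa [expDiff, Nat.pos_iff_ne_zero] using Finsupp.mem_support_iff.1 hi⟩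
  rw [RingHom.mem_ker, map_sub, quotientHom_monomial_of_subset hc,
    quotientHom_monomial_of_subset (by simp), sub_eq_zero] at h1
  exact mk_expDiff_eq_iff.1
    (Finsupp.single_left_injective one_ne_zero (congrArg AddMonoidAlgebra.coeff h1))

theorem latticeRank_le_encard_purePart {S : Set (MvPolynomial (Fin n) k)} (hfin : S.Finite)
    (hS : ∀ B ∈ S, IsBinomial B) (hspan : Ideal.span S = latticeIdeal k L) :
    (latticeRank (pureSublattice L) : ℕ∞) ≤ (purePart L S).encard := by
  obtain ⟨g, -, hg⟩ := exists_expDiff_closure hS hspan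
  have hfin' : (g '' purePart L S).Finite := (hfin.subset (purePart_subset S)).image g
  refine le_trans ?_ (Set.encard_image_le g _)
  have := hfin'.fintype
  rw [Set.encard_eq_coe_toFinset_card, Nat.cast_le]
  refine le_trans ?_ (finrank_span_le_card (R := ℤ) (g '' purePart L S))
  have hle : AddSubgroup.toIntSubmodule (pureSublattice L) ≤
      Submodule.span ℤ (g '' purePart L S) := by
    rw [← AddSubgroup.toIntSubmodule_closure]
    exact AddSubgroup.toIntSubmodule.monotone hg
  exact Submodule.finrank_mono hle

theorem monomial_sub_mem_of_closure {J : Ideal (MvPolynomial (Fin n) k)}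
    {C : Set (Fin n →₀ ℕ)} (hC : ∀ c ∈ C, monomial c (1 : k) - 1 ∈ J) {u v : Fin n →₀ ℕ}
    (h : expDiff u v ∈ AddSubgroup.closure ((fun c => expDiff c 0) '' C)) :
    monomial u (1 : k) - monomial v 1 ∈ J := by
  have hmul : ∀ s t : Fin n →₀ ℕ, monomial (s + t) (1 : k) = monomial s 1 * monomial t 1 := by
    intro s t
    rw [monomial_mul, one_mul]
  -- The differences `a - b` with `x^a` and `x^b` congruent to `1` modulo `J` form a subgroup.
  have key : ∃ a b : Fin n →₀ ℕ, expDiff a b = expDiff u v ∧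
      monomial a (1 : k) - 1 ∈ J ∧ monomial b (1 : k) - 1 ∈ J := by
    generalize expDiff u v = t at h
    have hadd : ∀ s t : Fin n →₀ ℕ, monomial s (1 : k) - 1 ∈ J → monomial t (1 : k) - 1 ∈ J →
        monomial (s + t) (1 : k) - 1 ∈ J := by
      intro s t hs ht
      have : monomial (s + t) (1 : k) - 1 =
          monomial s 1 * (monomial t 1 - 1) + (monomial s 1 - 1) := by rw [hmul]; ring
      rw [this]
      exact J.add_mem (J.mul_mem_left _ ht) hs
    induction h using AddSubgroup.closure_induction with
    | mem x hx =>
      obtain ⟨c, hc, rfl⟩ := hx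
      exact ⟨c, 0, rfl, hC c hc, by simp⟩
    | zero => exact ⟨0, 0, by simp, by simp, by simp⟩
    | add x y _ _ hx hy =>
      obtain ⟨a, b, rfl, h1, h2⟩ := hx
      obtain ⟨a', b', rfl, h1', h2'⟩ := hy
      exact ⟨a + a', b + b', expDiff_add _ _ _ _, hadd _ _ h1 h1', hadd _ _ h2 h2'⟩
    | neg x _ hx =>
      obtain ⟨a, b, rfl, h1, h2⟩ := hx
      exact ⟨b, a, expDiff_swap _ _, h2, h1⟩
  obtain ⟨a, b, hab, ha, hb⟩ := key
  have heq : u + b = v + a := by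
    ext i
    have := congrFun hab i
    simp only [expDiff, Finsupp.add_apply] at this ⊢
    omega
  have : monomial u (1 : k) - monomial v 1 =
      monomial v 1 * (monomial a 1 - 1) - monomial u 1 * (monomial b 1 - 1) := by
    rw [mul_sub, mul_sub, ← hmul, ← hmul, heq]
    ring
  rw [this]
  exact J.sub_mem (J.mul_mem_left _ ha) (J.mul_mem_left _ hb)

/-- Replacing the pure part of a Markov basis by binomials `x^c - 1`, for generators `c` of
`L_pure`, and multiplying the other elements by a monomial that is `1` modulo `I_L` gives again a
Markov basis. -/
theorem IsMarkovBasis.replace_purePart {S : Set (MvPolynomial (Fin n) k)}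
    (hS : IsMarkovBasis (latticeIdeal k L) S) {C : Set (Fin n →₀ ℕ)} (hC0 : 0 ∉ C)
    (hCcard : C.encard ≤ latticeRank (pureSublattice L))
    (hC : AddSubgroup.closure ((fun c => expDiff c 0) '' C) = pureSublattice L)
    {d : Fin n →₀ ℕ} (hd : expDiff d 0 ∈ L) :
    IsMarkovBasis (latticeIdeal k L) ((fun c => monomial c (1 : k) - 1) '' C ∪
      (fun f => monomial d 1 * f) '' (S \ purePart L S)) := by
  set T := (fun c => monomial c (1 : k) - 1) '' C ∪
      (fun f => monomial d 1 * f) '' (S \ purePart L S)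
  have hSI : ∀ B ∈ S, B ∈ latticeIdeal k L := fun B hB => hS.1.2.1 ▸ Ideal.subset_span hB
  have hCT : ∀ c ∈ C, monomial c (1 : k) - 1 ∈ Ideal.span T := fun c hc =>
    Ideal.subset_span (Or.inl ⟨c, hc, rfl⟩)
  have hpure : ∀ u v : Fin n →₀ ℕ, expDiff u v ∈ pureSublattice L →
      monomial u (1 : k) - monomial v 1 ∈ Ideal.span T := fun u v h =>
    monomial_sub_mem_of_closure hCT (hC ▸ h)
  refine hS.of_encard_le ?_ (le_antisymm ?_ ?_) ?_
  · rintro _ (⟨c, hc, rfl⟩ | ⟨f, hf, rfl⟩)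
    · exact isBinomial_sub (v := 0) fun h => hC0 (h ▸ hc)
    · obtain ⟨u, v, a, huv, ha, -, rfl⟩ := exists_eq_smul_of_mem (hS.1.1 f hf.1) (hSI f hf.1)
      have : monomial d 1 * a • (monomial u (1 : k) - monomial v 1) =
          a • (monomial (d + u) 1 - monomial (d + v) 1) := by
        simp [mul_sub, monomial_mul]
      simp only [this]
      exact isBinomial_smul_sub (fun h => huv (add_left_cancel h)) ha
  · rw [Ideal.span_le]
    rintro _ (⟨c, hc, rfl⟩ | ⟨f, hf, rfl⟩)
    · exact monomial_sub_mem_latticeIdeal (v := 0)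
        (pureSublattice_le L (hC ▸ AddSubgroup.subset_closure ⟨c, hc, rfl⟩))
    · exact Ideal.mul_mem_left _ _ (hSI f hf.1)
  · rw [← hS.1.2.1, Ideal.span_le]
    intro B hB
    by_cases hBp : B ∈ purePart L S
    · obtain ⟨u, v, a, huv, ha, hL, rfl⟩ := exists_eq_smul_of_mem (hS.1.1 B hB) (hSI B hB)
      refine Submodule.smul_of_tower_mem _ a (hpure u v (mem_pureSublattice_of_support hL ?_))
      intro i hi
      have h0 : ∀ t ∈ ({u, v} : Finset (Fin n →₀ ℕ)), t i = 0 := by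
        rw [← support_smul_sub huv ha]
        exact fun t ht => Finsupp.notMem_support_iff.1 (mt (hBp.2 t ht i) hi)
      simp [expDiff, h0 u, h0 v]
    -- Since `d` lies in `L_pure`, `x^d` is `1` modulo the span of `T`, so `B` is recovered from
    -- `x^d B`.
    · have hd1 : monomial d (1 : k) - monomial 0 1 ∈ Ideal.span T := hpure d 0
        (AddSubgroup.subset_closure ⟨hd, fun i => by simp [expDiff]⟩)
      have h1 : monomial d 1 * B ∈ Ideal.span T :=
        Ideal.subset_span (Or.inr ⟨B, ⟨hB, hBp⟩, rfl⟩)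
      have : B = monomial d 1 * B - B * (monomial d (1 : k) - monomial 0 1) := by
        rw [show monomial (0 : Fin n →₀ ℕ) (1 : k) = 1 from rfl]
        ring
      rw [SetLike.mem_coe, this]
      exact Ideal.sub_mem _ h1 (Ideal.mul_mem_left _ _ hd1)
  · calc T.encard ≤ C.encard + (S \ purePart L S).encard :=
          (Set.encard_union_le _ _).trans
            (add_le_add (Set.encard_image_le _ _) (Set.encard_image_le _ _))
      _ ≤ (purePart L S).encard + (S \ purePart L S).encard := by
          gcongr
          exact hCcard.trans (latticeRank_le_encard_purePart hS.finite hS.1.1 hS.1.2.1)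
      _ = S.encard := by
          rw [add_comm, Set.encard_sdiff_add_encard_of_subset (purePart_subset S)]

end PurePart

/-! ### Indispensable monomials and binomials -/

section Indispensable

variable {k : Type*} [Field k] {n : ℕ} {L : AddSubgroup (Fin n → ℤ)}

theorem exists_markovBasis (L : AddSubgroup (Fin n → ℤ)) :
    ∃ S, IsMarkovBasis (latticeIdeal k L) S := by
  obtain ⟨S, hS, -⟩ := exists_markovBasis_le (I := latticeIdeal k L)
    (G := {f | ∃ u v : Fin n →₀ ℕ, u ≠ v ∧ expDiff u v ∈ L ∧ f = monomial u 1 - monomial v 1})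
    (by rintro _ ⟨u, v, huv, -, rfl⟩; exact isBinomial_sub huv)
    (le_antisymm (Ideal.span_mono fun _ ⟨u, v, _, h, hf⟩ => ⟨u, v, h, hf⟩) (by
      rw [latticeIdeal, Ideal.span_le]
      rintro _ ⟨u, v, h, rfl⟩
      by_cases huv : u = v
      · simp [huv]
      · exact Ideal.subset_span ⟨u, v, huv, h, rfl⟩))
  exact ⟨S, hS⟩

/-- Otherwise all generators, and so all of `I_L`, would have zero constant term, unlike `x^c - 1`
for a nonzero `c ∈ L ∩ ℕⁿ`. -/
theorem isIndispensableMonomial_zero (hne : (pureSupport L).Nonempty) :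
    IsIndispensableMonomial (latticeIdeal k L) 0 := by
  intro S hS
  by_contra! hno
  obtain ⟨i, w, hw, hw0, hwi⟩ := hne
  obtain ⟨c, rfl⟩ := exists_exponent hw0
  have hc0 : c ≠ 0 := by
    rintro rfl
    simp at hwi
  have hle : latticeIdeal k L ≤ RingHom.ker (constantCoeff (R := k) (σ := Fin n)) := by
    rw [← hS.1.2.1, Ideal.span_le]
    exact fun B hB => notMem_support_iff.1 (hno B hB)
  have h := hle (monomial_sub_mem_latticeIdeal hw)
  rw [RingHom.mem_ker, map_sub, constantCoeff_monomial, constantCoeff_monomial] at h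
  simp [hc0] at h

theorem not_isIndispensableMonomial {C : Set (Fin n →₀ ℕ)} (hC0 : 0 ∉ C)
    (hCcard : C.encard ≤ latticeRank (pureSublattice L))
    (hC : AddSubgroup.closure ((fun c => expDiff c 0) '' C) = pureSublattice L)
    (hne : (pureSupport L).Nonempty) {u : Fin n →₀ ℕ} (hu0 : u ≠ 0) (huC : u ∉ C) :
    ¬ IsIndispensableMonomial (latticeIdeal k L) u := by
  intro hu
  obtain ⟨i, hi⟩ := hne
  -- With `d i > u i`, no multiple of `x^d` has `x^u` as a term.
  obtain ⟨w, hw, hw0, hwi⟩ := exists_large_on_pureSupport L (u i)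
  obtain ⟨d, rfl⟩ := exists_exponent hw0
  have hdi := hwi i hi
  obtain ⟨S, hS⟩ := exists_markovBasis (k := k) L
  obtain ⟨_, ⟨c, hc, rfl⟩ | ⟨f, -, rfl⟩, hB⟩ := hu _ (hS.replace_purePart hC0 hCcard hC hw)
  · have h := support_sub _ _ _ hB
    rw [Finset.mem_union, show (1 : MvPolynomial (Fin n) k) = monomial 0 1 from rfl] at h
    rcases h with h | h
    · exact huC ((Finset.mem_singleton.1 (support_monomial_subset h)) ▸ hc)
    · exact hu0 (Finset.mem_singleton.1 (support_monomial_subset h))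
  · rw [mem_support_iff, coeff_monomial_mul'] at hB
    have hdu : d ≤ u := by
      by_contra h
      simp [h] at hB
    have := hdu i
    simp only [expDiff, Finsupp.coe_zero, Pi.zero_apply] at hdi
    omega

theorem IsIndispensableBinomial.isIndispensableMonomial {I : Ideal (MvPolynomial (Fin n) k)}
    {B : MvPolynomial (Fin n) k} (hB : IsIndispensableBinomial I B) {u : Fin n →₀ ℕ}
    (hu : u ∈ B.support) : IsIndispensableMonomial I u := by
  intro S hS
  obtain ⟨c, hc, hcB⟩ := hB.2 S hS
  refine ⟨c • B, hcB, ?_⟩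
  rw [mem_support_iff] at hu ⊢
  rw [coeff_smul]
  exact smul_ne_zero hc hu

theorem IsIndispensableBinomial.exists_eq_smul {B : MvPolynomial (Fin n) k}
    (hB : IsIndispensableBinomial (latticeIdeal k L) B) :
    ∃ (u v : Fin n →₀ ℕ) (a : k), u ≠ v ∧ a ≠ 0 ∧ B = a • (monomial u 1 - monomial v 1) ∧
      IsIndispensableMonomial (latticeIdeal k L) u ∧
      IsIndispensableMonomial (latticeIdeal k L) v := by
  obtain ⟨S, hS⟩ := exists_markovBasis (k := k) L
  obtain ⟨c, hc, hcB⟩ := hB.2 S hS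
  have hmem : B ∈ latticeIdeal k L := by
    have h := Submodule.smul_of_tower_mem (latticeIdeal k L) c⁻¹
      (hS.1.2.1 ▸ Ideal.subset_span hcB : c • B ∈ latticeIdeal k L)
    rwa [inv_smul_smul₀ hc] at h
  obtain ⟨u, v, a, huv, ha, -, hBeq⟩ := exists_eq_smul_of_mem hB.1 hmem
  have hsupp : B.support = {u, v} := hBeq ▸ support_smul_sub huv ha
  exact ⟨u, v, a, huv, ha, hBeq, hB.isIndispensableMonomial (by simp [hsupp]),
    hB.isIndispensableMonomial (by simp [hsupp])⟩

theorem isIndispensableMonomial_iff_of_one_lt_rank (hr : 1 < latticeRank (pureSublattice L))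
    (u : Fin n →₀ ℕ) : IsIndispensableMonomial (latticeIdeal k L) u ↔ u = 0 := by
  have hne : (pureSupport L).Nonempty := pureSupport_nonempty (by omega)
  refine ⟨fun hu => ?_, fun h => h ▸ isIndispensableMonomial_zero hne⟩
  by_contra hu0
  obtain ⟨i, hi⟩ := hne
  obtain ⟨c, hc, hcl⟩ := exists_large_generators hr (u i)
  refine not_isIndispensableMonomial (C := Set.range c) ?_ ?_ ?_ ⟨i, hi⟩ hu0 ?_ hu
  · rintro ⟨j, hj⟩
    simpa [hj] using hc j i hi
  · rw [← Set.image_univ]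
    exact (Set.encard_image_le _ _).trans (by simp)
  · rw [← Set.range_comp]
    exact hcl
  · rintro ⟨j, hj⟩
    simpa [hj] using hc j i hi

/-- The pure part of a Markov basis is a single binomial, namely the one containing the monomial
`1`. It is a multiple of some `x^t - 1`, where `t` and `w` generate the same subgroup; both being
nonnegative, they coincide. -/
theorem isIndispensableBinomial_of_closure {w : Fin n →₀ ℕ} (hw0 : w ≠ 0)
    (hr : latticeRank (pureSublattice L) = 1)
    (hw : AddSubgroup.closure {expDiff w 0} = pureSublattice L) :
    IsIndispensableBinomial (latticeIdeal k L) (monomial w 1 - monomial 0 1) := by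
  refine ⟨isBinomial_sub hw0, fun S hS => ?_⟩
  have hne : (pureSupport L).Nonempty := pureSupport_nonempty (by omega)
  have hT := hS.replace_purePart (C := {w}) (d := 0) (by simpa using hw0.symm)
    (by simp [hr]) (by simpa using hw) (by simp)
  -- The replacement with `d = 0` trades the pure part for one binomial, and `S` is no larger than
  -- the result.
  have hcard : (purePart L S).encard ≤ 1 := by
    have h1 := hS.encard_le hT.1.1 hT.1.2.1
    have h2 : S.encard ≤ 1 + (S \ purePart L S).encard :=
      h1.trans ((Set.encard_union_le _ _).trans
        (add_le_add (by simp) (Set.encard_image_le _ _)))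
    rw [← Set.encard_sdiff_add_encard_of_subset (purePart_subset (L := L) S), add_comm] at h2
    exact (ENat.add_le_add_iff_right
      (Set.encard_ne_top_iff.2 (hS.finite.subset Set.sdiff_subset))).1 h2
  obtain ⟨g, hg, hgcl⟩ := exists_expDiff_closure hS.1.1 hS.1.2.1
  obtain ⟨B, hBS, hB0⟩ := isIndispensableMonomial_zero hne S hS
  obtain ⟨u, v, a, huv, ha, hL, hBeq, hgB⟩ := hg B hBS
  have hsupp : B.support = {u, v} := hBeq ▸ support_smul_sub huv ha
  obtain ⟨t, s, ht0, hts, hsB⟩ : ∃ (t : Fin n →₀ ℕ) (s : k), t ≠ 0 ∧ s ≠ 0 ∧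
      (s • B = monomial t 1 - monomial 0 1 ∧ expDiff t 0 ∈ L ∧
        (expDiff t 0 = g B ∨ expDiff t 0 = - g B)) := by
    rw [hsupp, Finset.mem_insert, Finset.mem_singleton] at hB0
    rcases hB0 with rfl | rfl
    · refine ⟨v, -a⁻¹, huv.symm, by simpa using ha, ?_, ?_, Or.inr ?_⟩
      · rw [hBeq, neg_smul, inv_smul_smul₀ ha, neg_sub]
      · rw [expDiff_swap]
        exact L.neg_mem hL
      · rw [hgB, expDiff_swap]
    · exact ⟨u, a⁻¹, huv, inv_ne_zero ha, by rw [hBeq, inv_smul_smul₀ ha], hL, Or.inl hgB.symm⟩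
  obtain ⟨hsB, htL, htg⟩ := hsB
  have htpure : expDiff t 0 ∈ AddSubgroup.closure {expDiff w 0} :=
    hw ▸ AddSubgroup.subset_closure ⟨htL, fun i => by simp [expDiff]⟩
  have hBpure : B ∈ purePart L S := by
    refine ⟨hBS, ?_⟩
    rw [hsupp] at hB0 ⊢
    have hv := support_subset_pureSupport hL
    have hu := support_subset_pureSupport (u := v) (v := u)
      (by rw [expDiff_swap]; exact L.neg_mem hL)
    rw [Finset.mem_insert, Finset.mem_singleton] at hB0
    rcases hB0 with rfl | rfl
    · simpa using hv
    · simpa using hu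
  have hpure : purePart L S = {B} := by
    ext x
    exact ⟨fun hx => Set.encard_le_one_iff.1 hcard x B hx hBpure, fun hx => hx ▸ hBpure⟩
  have hwt : expDiff w 0 ∈ AddSubgroup.closure {expDiff t 0} := by
    have h : expDiff w 0 ∈ AddSubgroup.closure {g B} := by
      have := hgcl (hw ▸ AddSubgroup.subset_closure rfl : expDiff w 0 ∈ pureSublattice L)
      rwa [hpure, Set.image_singleton] at this
    rw [AddSubgroup.mem_closure_singleton] at h ⊢
    obtain ⟨z, hz⟩ := h
    rcases htg with h' | h'
    · exact ⟨z, by rw [h', hz]⟩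
    · exact ⟨-z, by rw [h', neg_smul_neg, hz]⟩
  rw [AddSubgroup.mem_closure_singleton] at htpure hwt
  obtain ⟨z, hz⟩ := htpure
  obtain ⟨y, hy⟩ := hwt
  have htw : w = t := by
    obtain ⟨i, hi⟩ := DFunLike.ne_iff.1 hw0
    have hzi : ∀ i, z * (w i : ℤ) = t i := fun i => by simpa [expDiff] using congrFun hz i
    have hyi : ∀ i, y * (t i : ℤ) = w i := fun i => by simpa [expDiff] using congrFun hy i
    have hwi : (0 : ℤ) < w i := by
      have : w i ≠ 0 := hi
      omega
    have hyz : y * z = 1 := by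
      have h := hyi i
      rw [← hzi i, ← mul_assoc] at h
      exact mul_right_cancel₀ hwi.ne' (h.trans (one_mul _).symm)
    have hz0 : 0 ≤ z := by
      have h := hzi i
      by_contra hneg
      have : z * (w i : ℤ) < 0 := mul_neg_of_neg_of_pos (by omega) hwi
      omega
    have hz1 : z = 1 := by
      rcases Int.eq_one_or_neg_one_of_mul_eq_one' hyz with h | h <;> omega
    ext j
    have := hzi j
    rw [hz1] at this
    omega
  exact ⟨s⁻¹, inv_ne_zero hts, by rwa [htw, ← hsB, inv_smul_smul₀ hts]⟩

end Indispensable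
end LatticeIdeal

theorem theorem4p15 {k : Type*} [Field k] {n : ℕ} (L : AddSubgroup (Fin n → ℤ)) :
    (1 < LatticeIdeal.latticeRank (LatticeIdeal.pureSublattice L) →
      (¬ ∃ B, LatticeIdeal.IsIndispensableBinomial (LatticeIdeal.latticeIdeal k L) B) ∧
      ∀ u, LatticeIdeal.IsIndispensableMonomial (LatticeIdeal.latticeIdeal k L) u ↔ u = 0) ∧
    (LatticeIdeal.latticeRank (LatticeIdeal.pureSublattice L) = 1 →
      (∃ B, LatticeIdeal.IsIndispensableBinomial (LatticeIdeal.latticeIdeal k L) B ∧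
        ∀ B', LatticeIdeal.IsIndispensableBinomial (LatticeIdeal.latticeIdeal k L) B' →
          ∃ c : k, c ≠ 0 ∧ B' = c • B) ∧
      {u | LatticeIdeal.IsIndispensableMonomial (LatticeIdeal.latticeIdeal k L) u}.ncard = 2) := by
  open LatticeIdeal in
  refine ⟨fun hr => ⟨?_, isIndispensableMonomial_iff_of_one_lt_rank hr⟩, fun hr => ?_⟩
  · rintro ⟨B, hB⟩
    obtain ⟨u, v, a, huv, -, -, hu, hv⟩ := hB.exists_eq_smul
    rw [isIndispensableMonomial_iff_of_one_lt_rank hr] at hu hv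
    exact huv (hu.trans hv.symm)
  · obtain ⟨w, hw0, hw⟩ := exists_generator_of_rank_one hr
    have hne : (pureSupport L).Nonempty := pureSupport_nonempty (by omega)
    have hB := isIndispensableBinomial_of_closure (k := k) hw0 hr hw
    have hmon : ∀ u, IsIndispensableMonomial (latticeIdeal k L) u ↔ u = 0 ∨ u = w := by
      refine fun u => ⟨fun hu => ?_, ?_⟩
      · by_contra! h
        exact not_isIndispensableMonomial (C := {w}) (by simpa using hw0.symm) (by simp [hr])
          (by simpa using hw) hne h.1 h.2 hu
      · rintro (rfl | rfl)
        · exact isIndispensableMonomial_zero hne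
        · refine hB.isIndispensableMonomial ?_
          rw [← one_smul k (_ - _), support_smul_sub hw0 one_ne_zero]
          simp
    refine ⟨⟨_, hB, fun B' hB' => ?_⟩, ?_⟩
    · obtain ⟨u, v, a, huv, ha, rfl, hu, hv⟩ := hB'.exists_eq_smul
      rw [hmon] at hu hv
      rcases hu with rfl | rfl <;> rcases hv with rfl | rfl
      · exact absurd rfl huv
      · exact ⟨-a, neg_ne_zero.2 ha, by rw [neg_smul, ← smul_neg, neg_sub]⟩
      · exact ⟨a, ha, rfl⟩
      · exact absurd rfl huv
    · have : {u | IsIndispensableMonomial (latticeIdeal k L) u} = {0, w} := by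
        ext u
        exact hmon u
      rw [this, Set.ncard_pair hw0.symm]
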